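/- Let $L$ be a frame. A sublocale of $L$ is a subset closed under all meets and under $x\to(-)$ for every $x\in L$; $\mathsf{S}(L)$ is the coframe of all sublocales ordered by inclusion. For $a\in L$ put $\mathfrak{o}(a)=\{a\to b: b\in L\}$ and $\mathfrak{c}(a)=\{x\in L: a\le x\}$. Let $\mathsf{S}_{\mathfrak{o}}(L)\subseteq \mathsf{S}(L)$ be the set of all intersections of open sublocales $\mathfrak{o}(a)$, and $\mathsf{S}_{\mathfrak{c}}(L)\subseteq \mathsf{S}(L)$ the set of all joins in $\mathsf{S}(L)$ of closed sublocales $\mathfrak{c}(a)$. $L$ is scattered if $\mathsf{S}(L)$ is Boolean, and subfit if whenever $x\not\le y$ there is $u\in L$ with $x\vee u=1$ and $y\vee u\ne 1$. A meet $\bigwedge_i x_i$ in $L$ is exact if $(\bigwedge_i x_i)\vee a=\bigwedge_i(x_i\vee a)$ for all $a\in L$, and strongly exact if for every $y\in L$, $x_i\to y=y$ for all $i$ implies $(\bigwedge_i x_i)\to y=y$. A filter of $L$ (possibly improper) is exact (strongly exact) if it is closed under exact (strongly exact) meets, and regular if it is of the form $F\to\{1\}$ in the frame of all filters of $L$ ordered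 by inclusion. Write $\mathsf{Filt}_{\mathcal{E}}(L)$, $\mathsf{Filt}_{\mathcal{SE}}(L)$, $\mathsf{Filt}_{\mathcal{R}}(L)$ for the collections of exact, strongly exact and regular filters. A Raney extension of $L$ is a pair $(L,C)$ where $C$ is a coframe together with an embedding $L\hookrightarrow C$ that preserves arbitrary joins, finite meets and strongly exact meets, such that every element of $C$ is a meet of elements of $L$. An isomorphism of Raney extensions $(L,C)\cong(L,D)$ is a coframe isomorphism $C\cong D$ that restricts to a frame automorphism of $L$; it is an isomorphism over $L$ if this restriction is the identity. Proposition. For a subfit frame $L$, the following are equivalent. 1. $L$ is scattered. 2. $\mathsf{Filt}_{\mathcal{SE}}(L)=\mathsf{Filt}_{\mathcal{E}}(L)=\mathsf{Filt}_{\mathcal{R}}(L)$. 3. $\mathsf{Filt}_{\mathcal{SE}}(L)=\mathsf{Filt}_{\mathcal{E}}(L)$. 4. $L$ has a unique Raney extension, up to isomorphism. 5. $\mathsf{S}_{\mathfrak{o}}(L)=\mathsf{S}_{\mathfrak{c}}(L)$. 6. $L$ has a unique Raney extension, up to isomorphism, and this is $(L,\mathsf{S}(L))$, with the embedding $a\mapsto\mathfrak{o}(a)$.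 Moreover, the variants of 4 and 6 in which "isomorphism" is replaced by "isomorphism over $L$" are also equivalent to these conditions. -/

import Mathlib

universe u v w x

/-- A frame is subfit if `x ≰ y` implies that some `u` satisfies `x ⊔ u = ⊤` and `y ⊔ u ≠ ⊤`. -/
def IsSubfit (L : Type u) [Order.Frame L] : Prop :=
  ∀ x y : L, ¬ x ≤ y → ∃ u : L, x ⊔ u = ⊤ ∧ y ⊔ u ≠ ⊤

/-- A frame is scattered if its coframe of sublocales (Mathlib's `Sublocale L`, ordered by
inclusion) is Boolean. -/
def IsScatteredFrame (L : Type u) [Order.Frame L] : Prop :=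
  ComplementedLattice (Sublocale L)

/-- The open sublocale `{a ⇨ b | b ∈ L}`. -/
def openSublocale {L : Type u} [Order.Frame L] (a : L) : Sublocale L where
  carrier := {x | ∃ b : L, x = a ⇨ b}
  sInf_mem' s hs := by
    refine ⟨sInf s, le_antisymm le_himp (le_sInf fun x hx => ?_)⟩
    obtain ⟨b, rfl⟩ := hs hx
    calc a ⇨ sInf s ≤ a ⇨ (a ⇨ b) := himp_le_himp_left (sInf_le hx)
      _ = a ⇨ b := himp_idem
  himp_mem' c x hx := by
    obtain ⟨b, rfl⟩ := hx
    exact ⟨c ⇨ b, himp_left_comm c a b⟩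

/-- The closed sublocale `{x | a ≤ x}`. -/
def closedSublocale {L : Type u} [Order.Frame L] (a : L) : Sublocale L where
  carrier := {x | a ≤ x}
  sInf_mem' _ hs := le_sInf fun _ hx => hs hx
  himp_mem' _ _ hb := le_trans hb le_himp

/-- The collection of fitted sublocales: the intersections of open sublocales. -/
def fittedSublocales (L : Type u) [Order.Frame L] : Set (Sublocale L) :=
  {S | ∃ A : Set L, S = ⨅ a ∈ A, openSublocale a}

/-- The collection of joins (in the coframe of sublocales) of closed sublocales. -/
def joinsOfClosedSublocales (L : Type u) [Order.Frame L] : Set (Sublocale L) :=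
  {S | ∃ A : Set L, S = ⨆ a ∈ A, closedSublocale a}

/-- The meet of `A` is exact. -/
def IsExactMeet {L : Type u} [Order.Frame L] (A : Set L) : Prop :=
  ∀ b : L, sInf A ⊔ b = ⨅ a ∈ A, a ⊔ b

/-- The meet of `A` is strongly exact. -/
def IsStronglyExactMeet {L : Type u} [Order.Frame L] (A : Set L) : Prop :=
  ∀ y : L, (∀ a ∈ A, a ⇨ y = y) → sInf A ⇨ y = y

/-- The exact filters: those closed under exact meets. The improper filter is allowed. -/
def exactFilters (L : Type u) [Order.Frame L] : Set (Order.PFilter L) :=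
  {F | ∀ A : Set L, (∀ a ∈ A, a ∈ F) → IsExactMeet A → sInf A ∈ F}

/-- The strongly exact filters: those closed under strongly exact meets. -/
def stronglyExactFilters (L : Type u) [Order.Frame L] : Set (Order.PFilter L) :=
  {F | ∀ A : Set L, (∀ a ∈ A, a ∈ F) → IsStronglyExactMeet A → sInf A ∈ F}

/-- The regular filters: the pseudocomplements `F → {⊤}` in the frame of all filters ordered by
inclusion, where `F → {⊤}` is the largest filter `H` with `H ∩ F = {⊤}`. -/
def regularFilters (L : Type u) [Order.Frame L] : Set (Order.PFilter L) :=
  {G | ∃ F : Order.PFilter L,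
    IsGreatest {H : Order.PFilter L | (H : Set L) ∩ (F : Set L) = {⊤}} G}

/-- `ι` exhibits `(L, C)` as a Raney extension: it embeds the frame `L` in the coframe `C`,
preserving the frame operations and the strongly exact meets, and the image of `L`
meet-generates `C`. -/
structure IsRaneyExtension {L : Type u} {C : Type v} [Order.Frame L] [Order.Coframe C]
    (ι : L → C) : Prop where
  injective : Function.Injective ι
  map_sSup : ∀ A : Set L, ι (sSup A) = ⨆ a ∈ A, ι a
  map_top : ι ⊤ = ⊤
  map_inf : ∀ a b : L, ι (a ⊓ b) = ι a ⊓ ι b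
  map_sInf : ∀ A : Set L, IsStronglyExactMeet A → ι (sInf A) = ⨅ a ∈ A, ι a
  meet_generates : ∀ c : C, ∃ A : Set L, c = ⨅ a ∈ A, ι a

/-- `(L, C)` and `(M, D)` are isomorphic Raney extensions: there is an isomorphism of coframes
`C ≅ D` that restricts to an isomorphism of frames `L ≅ M`. -/
def RaneyIsomorphic {L : Type u} {C : Type v} {M : Type w} {D : Type x} [Order.Frame L]
    [Order.Coframe C] [Order.Frame M] [Order.Coframe D] (ι : L → C) (κ : M → D) : Prop :=
  ∃ (e : C ≃o D) (σ : L ≃o M), ∀ a : L, e (ι a) = κ (σ a)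

/-- `(L, C)` and `(L, D)` are isomorphic over `L`: the identity of `L` extends to an isomorphism
of coframes `C ≅ D`. -/
def RaneyIsomorphicOver {L : Type u} {C : Type v} {D : Type w} [Order.Frame L]
    [Order.Coframe C] [Order.Coframe D] (ι : L → C) (κ : L → D) : Prop :=
  ∃ e : C ≃o D, ∀ a : L, e (ι a) = κ a

/-- `(L, C)` is a Raney extension of `L`, and the only one up to isomorphism. -/
def IsUniqueRaneyExtension {L C : Type u} [Order.Frame L] [Order.Coframe C] (ι : L → C) : Prop :=
  IsRaneyExtension ι ∧ ∀ (D : Type u) [Order.Coframe D] (κ : L → D),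
    IsRaneyExtension κ → RaneyIsomorphic ι κ

/-- `(L, C)` is a Raney extension of `L`, and the only one up to isomorphism over `L`. -/
def IsUniqueRaneyExtensionOver {L C : Type u} [Order.Frame L] [Order.Coframe C] (ι : L → C) :
    Prop :=
  IsRaneyExtension ι ∧ ∀ (D : Type u) [Order.Coframe D] (κ : L → D),
    IsRaneyExtension κ → RaneyIsomorphicOver ι κ

/-!
Write `𝔬 a` and `𝔠 a` for the open and the closed sublocale of `a`; they are complements of each
other, and `𝔠 b ≤ 𝔬 a` means `a ⊔ b = ⊤`.

**Filters.** A strongly exact filter `F` is recovered from the fitted sublocale `⨅ f ∈ F, 𝔬 f` as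
`{a | ⨅ f ∈ F, 𝔬 f ≤ 𝔬 a}` (`mem_of_iInf_openSublocale_le`). In a subfit frame an exact filter `F`
contains every `x` with `x ⊔ b = ⊤` for all `b` such that `f ⊔ b = ⊤` for all `f ∈ F`, because such
an `x` is the exact meet of the elements `x ⊔ f` (`IsSubfit.mem_of_forall_sup_eq_top`). Hence the
exact filters of a subfit frame are the regular ones.

**Scatteredness.** If `L` is subfit, every proper sublocale lies in some `𝔬 b` with `b ≠ ⊤`. So if
the lattice of sublocales is Boolean, a nonzero sublocale contains a nonzero closed one, and every
sublocale is a join of closed sublocales; taking complements, every sublocale is fitted. Conversely,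
if fitted sublocales and joins of closed sublocales are the same, then closed sublocales are fitted.
As every sublocale is an intersection of sublocales `𝔬 y ⊔ 𝔠 z`, all sublocales are then fitted
(`mem_fittedSublocales_of_forall_closedSublocale`), so they are joins of closed ones, and `⨆ a ∈ A,
𝔠 a` and `⨅ a ∈ A, 𝔬 a` are complements. If all strongly exact filters are exact, the recovery of
exact filters shows that a fitted sublocale `S` has the complement `⨅ b ∈ {b | 𝔠 b ≤ S}, 𝔬 b`. For
the fitted hull `S` of `𝔠 a` this complement is `𝔬 a`, so `𝔠 a` is fitted. Again all sublocales are
then fitted, hence complemented (`IsSubfit.isScatteredFrame_of_stronglyExactFilters_eq`).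

**Raney extensions.** An element `d` of a Raney extension `κ : L → D` is determined by the strongly
exact filter `{a | d ≤ κ a}`, and every exact filter of a subfit frame arises in this way. So if `L`
is subfit and scattered, all Raney extensions agree with `𝔬 : L → Sublocale L`
(`IsRaneyExtension.raneyIsomorphicOver`). For the converse, a family `φ` of sublocales that is
stable under intersection with closed sublocales yields, under a separation hypothesis, a Raney
extension: the concept lattice of the relation `φ b ≤ 𝔬 a` (`isRaneyExtension_conceptMap`). All
sublocales give an extension in which every strongly exact filter arises; the closed sublocales of a
subfit frame give one in which only exact filters arise. An isomorphism between the two, even one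
that moves `L`, forces strongly exact filters to be exact.
-/

section Frame

variable {L : Type u} [Order.Frame L]

/-! ### Open and closed sublocales -/

lemma Sublocale.mem_iInf_of_forall {ι : Sort*} {S : ι → Sublocale L} {x : L}
    (h : ∀ i, x ∈ S i) : x ∈ ⨅ i, S i := by
  let T : Sublocale L :=
    { carrier := {y | ∀ i, y ∈ S i}
      sInf_mem' := fun s hs i => (S i).sInf_mem fun y hy => hs hy i
      himp_mem' := fun a b hb i => (S i).himp_mem (hb i) }
  have hT : T ≤ ⨅ i, S i := le_iInf fun i y hy => hy i
  exact hT (show x ∈ T from h)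

lemma Sublocale.mem_inf_of_mem {S T : Sublocale L} {x : L} (hS : x ∈ S) (hT : x ∈ T) :
    x ∈ S ⊓ T := by
  rw [inf_eq_iInf]
  exact Sublocale.mem_iInf_of_forall fun b => by cases b <;> assumption

lemma mem_openSublocale {a x : L} : x ∈ openSublocale a ↔ a ⇨ x = x := by
  constructor
  · rintro ⟨b, rfl⟩
    exact himp_idem
  · exact fun h => ⟨x, h.symm⟩

lemma mem_closedSublocale {a x : L} : x ∈ closedSublocale a ↔ a ≤ x := Iff.rfl

lemma openSublocale_le_openSublocale {a b : L} : openSublocale a ≤ openSublocale b ↔ a ≤ b := by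
  constructor
  · intro h
    have hb := mem_openSublocale.1 (h (show a ⇨ b ∈ openSublocale a from ⟨b, rfl⟩))
    rwa [himp_left_comm, himp_self, himp_top, eq_comm, himp_eq_top_iff] at hb
  · intro h x hx
    rw [mem_openSublocale] at hx ⊢
    exact le_antisymm ((himp_le_himp_right h).trans hx.le) le_himp

lemma openSublocale_bot : openSublocale (⊥ : L) = ⊥ := by
  refine eq_bot_iff.2 fun x hx => ?_
  rw [mem_openSublocale, bot_himp] at hx
  exact hx ▸ Sublocale.top_mem

lemma openSublocale_top : openSublocale (⊤ : L) = ⊤ :=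
  eq_top_iff.2 fun _ _ => mem_openSublocale.2 top_himp

lemma openSublocale_inf (a b : L) :
    openSublocale (a ⊓ b) = openSublocale a ⊓ openSublocale b := by
  refine le_antisymm (le_inf (openSublocale_le_openSublocale.2 inf_le_left)
    (openSublocale_le_openSublocale.2 inf_le_right)) fun x hx => ?_
  have ha := mem_openSublocale.1 ((inf_le_left : openSublocale a ⊓ openSublocale b ≤ _) hx)
  have hb := mem_openSublocale.1 ((inf_le_right : openSublocale a ⊓ openSublocale b ≤ _) hx)
  rw [mem_openSublocale, ← himp_himp, hb, ha]

lemma openSublocale_sSup (A : Set L) :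
    openSublocale (sSup A) = ⨆ a ∈ A, openSublocale a := by
  refine le_antisymm (fun x hx => ?_)
    (iSup₂_le fun a ha => openSublocale_le_openSublocale.2 (le_sSup ha))
  rw [mem_openSublocale] at hx
  have hx' : x = ⨅ a : A, (a : L) ⇨ x := by
    conv_lhs => rw [← hx, sSup_eq_iSup']
    exact iSup_himp_eq
  rw [hx']
  exact Sublocale.iInf_mem fun a =>
    le_biSup openSublocale a.2 ⟨x, rfl⟩

lemma openSublocale_sup (a b : L) :
    openSublocale (a ⊔ b) = openSublocale a ⊔ openSublocale b := by
  rw [← sSup_pair, openSublocale_sSup, iSup_pair]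

lemma closedSublocale_le_openSublocale {a b : L} :
    closedSublocale b ≤ openSublocale a ↔ a ⊔ b = ⊤ := by
  constructor
  · intro h
    have := mem_openSublocale.1 (h (mem_closedSublocale.2 (le_sup_right : b ≤ a ⊔ b)))
    rw [← this, himp_eq_top_iff]
    exact le_sup_left
  · intro h x hx
    rw [mem_closedSublocale] at hx
    refine mem_openSublocale.2 (le_antisymm ?_ le_himp)
    calc a ⇨ x = (a ⇨ x) ⊓ (a ⊔ b) := by rw [h, inf_top_eq]
      _ = (a ⇨ x) ⊓ a ⊔ (a ⇨ x) ⊓ b := inf_sup_left _ _ _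
      _ ≤ x := sup_le himp_inf_le (inf_le_right.trans hx)

lemma isCompl_closedSublocale_openSublocale (a : L) :
    IsCompl (closedSublocale a) (openSublocale a) := by
  refine ⟨disjoint_iff_inf_le.2 fun x hx => ?_, codisjoint_iff_le_sup.2 fun x _ => ?_⟩
  · have hc := mem_closedSublocale.1
      ((inf_le_left : closedSublocale a ⊓ openSublocale a ≤ _) hx)
    have ho := mem_openSublocale.1
      ((inf_le_right : closedSublocale a ⊓ openSublocale a ≤ _) hx)
    rw [← ho, himp_eq_top_iff.2 hc]
    exact Sublocale.top_mem
  · have hx : x = (a ⊔ x) ⊓ (a ⇨ x) := by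
      rw [inf_sup_right, inf_himp, inf_eq_left.2 le_himp, sup_eq_right.2 inf_le_right]
    rw [hx]
    exact Sublocale.inf_mem
      ((le_sup_left : closedSublocale a ≤ _) (mem_closedSublocale.2 le_sup_left))
      ((le_sup_right : openSublocale a ≤ _) ⟨x, rfl⟩)

lemma closedSublocale_eq_bot {a : L} : closedSublocale a = ⊥ ↔ a = ⊤ := by
  rw [← le_bot_iff, ← openSublocale_bot, closedSublocale_le_openSublocale, bot_sup_eq]

lemma closedSublocale_sup (a b : L) :
    closedSublocale (a ⊔ b) = closedSublocale a ⊓ closedSublocale b := by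
  refine le_antisymm (le_inf (fun x hx => le_sup_left.trans hx) fun x hx => le_sup_right.trans hx)
    fun x hx => sup_le ?_ ?_
  · exact (inf_le_left : closedSublocale a ⊓ closedSublocale b ≤ _) hx
  · exact (inf_le_right : closedSublocale a ⊓ closedSublocale b ≤ _) hx

lemma closedSublocale_inf_le_openSublocale {x y : L} {S : Sublocale L} :
    closedSublocale x ⊓ S ≤ openSublocale y ↔ S ≤ openSublocale (x ⊔ y) := by
  rw [inf_comm, ← (isCompl_closedSublocale_openSublocale x).le_sup_right_iff_inf_left_le,
    openSublocale_sup, sup_comm]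

/-- A sublocale is the intersection of the sublocales `𝔬 y ⊔ 𝔠 (ν y)`, where `ν` is its nucleus.
This is the inclusion of `S` in each of them. -/
lemma Sublocale.le_openSublocale_sup_closedSublocale (S : Sublocale L) (y : L) :
    S ≤ openSublocale y ⊔ closedSublocale (S.restrict y : L) := by
  intro s hs
  set z := (S.restrict y : L)
  have hyz : y ⇨ s ≤ z ⇨ s := by
    rw [le_himp_comm]
    have h : y ≤ (y ⇨ s) ⇨ s := le_himp_comm.1 le_rfl
    exact S.giRestrict.gc.l_le (b := ⟨(y ⇨ s) ⇨ s, S.himp_mem hs⟩) h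
  -- `z ⇨ s = y ⇨ s` for `s ∈ S`, so the meet below is at most `(z ⇨ s) ⊓ (z ⊔ s) ≤ s`.
  have hs' : s = (y ⇨ s) ⊓ (z ⊔ s) := by
    refine le_antisymm (le_inf le_himp le_sup_right) ?_
    rw [inf_sup_left]
    exact sup_le ((inf_le_inf_right _ hyz).trans himp_inf_le) inf_le_right
  rw [hs']
  exact Sublocale.inf_mem ((le_sup_left : openSublocale y ≤ _) ⟨s, rfl⟩)
    ((le_sup_right : closedSublocale z ≤ _) (mem_closedSublocale.2 le_sup_left))

lemma Sublocale.mem_of_restrict_le {S : Sublocale L} {y : L} (h : (S.restrict y : L) ≤ y) :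
    y ∈ S := by
  have : (S.restrict y : L) = y := le_antisymm h (S.giRestrict.gc.le_u_l y)
  exact this ▸ (S.restrict y).2

/-! ### Exact and strongly exact meets and filters -/

lemma IsStronglyExactMeet.openSublocale_sInf {A : Set L} (hA : IsStronglyExactMeet A) :
    openSublocale (sInf A) = ⨅ a ∈ A, openSublocale a := by
  refine le_antisymm (le_iInf₂ fun a ha => openSublocale_le_openSublocale.2 (sInf_le ha))
    fun y hy => mem_openSublocale.2 (hA y fun a ha => mem_openSublocale.1 ?_)
  exact (iInf₂_le a ha : ⨅ a ∈ A, openSublocale a ≤ openSublocale a) hy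

lemma isStronglyExactMeet_of_iInf_openSublocale_le {A : Set L}
    (hA : ⨅ a ∈ A, openSublocale a ≤ openSublocale (sInf A)) : IsStronglyExactMeet A :=
  fun _ hy => mem_openSublocale.1 <| hA <| Sublocale.mem_iInf_of_forall fun a =>
    Sublocale.mem_iInf_of_forall fun ha => mem_openSublocale.2 (hy a ha)

lemma IsStronglyExactMeet.isExactMeet {A : Set L} (hA : IsStronglyExactMeet A) :
    IsExactMeet A := by
  intro f
  refine le_antisymm (le_iInf₂ fun a ha => sup_le_sup_right (sInf_le ha) f) ?_
  set d := ⨅ a ∈ A, a ⊔ f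
  set y := sInf A ⊔ f
  -- Since `d ≤ a ⊔ f` and `f ≤ y`, the implication `a ⇨ d ⇨ y` collapses to `d ⇨ y`; as
  -- `sInf A ≤ y`, strong exactness then forces `d ⇨ y = ⊤`.
  have key : sInf A ⇨ d ⇨ y = d ⇨ y := by
    refine hA _ fun a ha => le_antisymm ?_ le_himp
    have hd : d ≤ a ⊔ f := iInf₂_le a ha
    rw [le_himp_iff]
    calc (a ⇨ d ⇨ y) ⊓ d ≤ ((a ⇨ d ⇨ y) ⊓ d) ⊓ (a ⊔ f) := le_inf le_rfl (inf_le_right.trans hd)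
      _ = (a ⇨ d ⇨ y) ⊓ d ⊓ a ⊔ (a ⇨ d ⇨ y) ⊓ d ⊓ f := inf_sup_left _ _ _
      _ ≤ y := by
        refine sup_le ?_ (inf_le_right.trans le_sup_right)
        rw [inf_assoc, inf_comm d a, ← le_himp_iff, himp_himp]
  rwa [himp_left_comm, himp_eq_top_iff.2 (le_sup_left : sInf A ≤ y), himp_top, eq_comm,
    himp_eq_top_iff] at key

lemma exactFilters_subset_stronglyExactFilters : exactFilters L ⊆ stronglyExactFilters L :=
  fun _ hF A hA hSE => hF A hA hSE.isExactMeet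

/-- A strongly exact filter is recovered from its fitted sublocale: if `⨅ f ∈ F, 𝔬 f ≤ 𝔬 a`, then
`a` is the strongly exact meet of the elements `f ⊔ a` with `f ∈ F`. -/
lemma mem_of_iInf_openSublocale_le {F : Order.PFilter L} (hF : F ∈ stronglyExactFilters L) {a : L}
    (ha : ⨅ f ∈ F, openSublocale f ≤ openSublocale a) : a ∈ F := by
  have hle : ⨅ x ∈ (· ⊔ a) '' (F : Set L), openSublocale x ≤ openSublocale a := by
    rw [iInf_image]
    simp only [openSublocale_sup, SetLike.mem_coe]
    simp only [← iInf_sup_eq]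
    exact sup_le ha le_rfl
  have hinf : sInf ((· ⊔ a) '' (F : Set L)) = a := by
    refine le_antisymm (openSublocale_le_openSublocale.1 (le_trans ?_ hle))
      (le_sInf ?_)
    · exact le_iInf₂ fun x hx => openSublocale_le_openSublocale.2 (sInf_le hx)
    · rintro _ ⟨f, -, rfl⟩
      exact le_sup_right
  have := hF ((· ⊔ a) '' (F : Set L)) ?_ (isStronglyExactMeet_of_iInf_openSublocale_le ?_)
  · rwa [hinf] at this
  · rintro _ ⟨f, hf, rfl⟩
    exact Order.PFilter.mem_of_le le_sup_left hf
  · rwa [hinf]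

/-- In a subfit frame an exact filter `F` contains `x` as soon as `x` joins to `⊤` with all
elements that join to `⊤` with all of `F`. -/
lemma IsSubfit.mem_of_forall_sup_eq_top (hL : IsSubfit L) {F : Order.PFilter L}
    (hF : F ∈ exactFilters L) {x : L} (hx : ∀ b, (∀ f ∈ F, f ⊔ b = ⊤) → x ⊔ b = ⊤) : x ∈ F := by
  have key (c : L) : ⨅ f ∈ F, f ⊔ x ⊔ c ≤ x ⊔ c := by
    by_contra h
    obtain ⟨u, hu, hu'⟩ := hL _ _ h
    refine hu' ?_
    have := hx (x ⊔ c ⊔ u) fun f hf => top_unique ?_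
    · rwa [← sup_assoc, ← sup_assoc, sup_idem] at this
    · rw [← hu, ← sup_assoc, ← sup_assoc]
      exact sup_le_sup_right (iInf₂_le f hf) u
  have hinf : sInf ((· ⊔ x) '' (F : Set L)) = x := by
    refine le_antisymm ?_ (le_sInf ?_)
    · simpa [sInf_image] using key ⊥
    · rintro _ ⟨f, -, rfl⟩
      exact le_sup_right
  rw [← hinf]
  refine hF _ ?_ fun c => le_antisymm
    (le_iInf₂ fun a ha => sup_le_sup_right (sInf_le ha) c) ?_
  · rintro _ ⟨f, hf, rfl⟩
    exact Order.PFilter.mem_of_le le_sup_left hf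
  · rw [hinf, iInf_image]
    exact key c

/-- The pseudocomplement `F → {⊤}` in the frame of filters. -/
def filterPseudocompl (F : Order.PFilter L) : Order.PFilter L :=
  Order.IsPFilter.toPFilter (F := {a : L | ∀ f ∈ F, a ⊔ f = ⊤}) <|
    Order.IsPFilter.of_def ⟨⊤, fun _ _ => top_sup_eq _⟩
      (fun a ha b hb => ⟨a ⊓ b, fun f hf => by rw [sup_inf_right, ha f hf, hb f hf, inf_top_eq],
        inf_le_left, inf_le_right⟩)
      fun hab ha f hf => top_unique ((ha f hf).symm.le.trans (sup_le_sup_right hab f))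

lemma mem_filterPseudocompl {F : Order.PFilter L} {a : L} :
    a ∈ filterPseudocompl F ↔ ∀ f ∈ F, a ⊔ f = ⊤ := Iff.rfl

lemma isGreatest_filterPseudocompl (F : Order.PFilter L) :
    IsGreatest {H : Order.PFilter L | (H : Set L) ∩ (F : Set L) = {⊤}} (filterPseudocompl F) := by
  constructor
  · ext a
    constructor
    · rintro ⟨ha, haF⟩
      have := mem_filterPseudocompl.1 ha a haF
      rwa [sup_idem] at this
    · rintro rfl
      exact ⟨Order.PFilter.top_mem, Order.PFilter.top_mem⟩
  · intro H hH a ha f hf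
    have : a ⊔ f ∈ (H : Set L) ∩ (F : Set L) :=
      ⟨Order.PFilter.mem_of_le le_sup_left ha, Order.PFilter.mem_of_le le_sup_right hf⟩
    rwa [hH] at this

lemma mem_regularFilters {G : Order.PFilter L} :
    G ∈ regularFilters L ↔ ∃ F, G = filterPseudocompl F :=
  exists_congr fun F => ⟨fun h => h.unique (isGreatest_filterPseudocompl F),
    fun h => h ▸ isGreatest_filterPseudocompl F⟩

lemma IsSubfit.exactFilters_eq_regularFilters (hL : IsSubfit L) :
    exactFilters L = regularFilters L := by
  ext G
  rw [mem_regularFilters]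
  constructor
  · intro hG
    refine ⟨filterPseudocompl G, le_antisymm (fun a ha f hf => ?_) fun a ha => ?_⟩
    · rw [sup_comm]
      exact hf a ha
    · exact hL.mem_of_forall_sup_eq_top hG fun b hb =>
        ha b fun f hf => (sup_comm _ _).trans (hb f hf)
  · rintro ⟨F, rfl⟩ A hA hex f hf
    change sInf A ⊔ f = ⊤
    rw [hex f]
    exact iInf₂_eq_top.2 fun a ha => hA a ha f hf

/-! ### Scattered subfit frames -/

/-- A proper sublocale of a subfit frame lies in a proper open sublocale. -/
lemma IsSubfit.exists_le_openSublocale (hL : IsSubfit L) {S : Sublocale L} (hS : S ≠ ⊤) :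
    ∃ b : L, b ≠ ⊤ ∧ S ≤ openSublocale b := by
  obtain ⟨y, hy⟩ : ∃ y, y ∉ S := by
    by_contra! h
    exact hS (eq_top_iff.2 fun y _ => h y)
  obtain ⟨u, hu, hu'⟩ := hL _ _ fun h => hy (Sublocale.mem_of_restrict_le h)
  refine ⟨y ⊔ u, hu', (S.le_openSublocale_sup_closedSublocale y).trans (sup_le ?_ ?_)⟩
  · exact openSublocale_le_openSublocale.2 le_sup_left
  · rw [closedSublocale_le_openSublocale, sup_assoc, sup_comm u, hu, sup_top_eq]

lemma IsSubfit.mem_joinsOfClosedSublocales (hL : IsSubfit L) (hS : IsScatteredFrame L)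
    (S : Sublocale L) : S ∈ joinsOfClosedSublocales L := by
  have : ComplementedLattice (Sublocale L) := hS
  set R := ⨆ b ∈ {b | closedSublocale b ≤ S}, closedSublocale b
  have hRS : R ≤ S := iSup₂_le fun b hb => hb
  refine ⟨{b | closedSublocale b ≤ S}, le_antisymm ?_ hRS⟩
  obtain ⟨R', hR'⟩ := exists_isCompl R
  rw [hR'.le_left_iff, disjoint_iff]
  obtain ⟨V, hV⟩ := exists_isCompl (S ⊓ R')
  by_contra hne
  have hVtop : V ≠ ⊤ := by
    rintro rfl
    exact hne (disjoint_top.1 hV.disjoint)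
  obtain ⟨b, hb, hVb⟩ := hL.exists_le_openSublocale hVtop
  have hbW : closedSublocale b ≤ S ⊓ R' :=
    hV.le_left_iff.2 ((isCompl_closedSublocale_openSublocale b).disjoint.mono_right hVb)
  have hbR : closedSublocale b ≤ R :=
    le_biSup closedSublocale (show closedSublocale b ≤ S from hbW.trans inf_le_left)
  exact hb (closedSublocale_eq_bot.1
    (le_bot_iff.1 (hR'.disjoint hbR (hbW.trans inf_le_right))))

lemma isCompl_iSup_closedSublocale_iInf_openSublocale
    (hJ : ∀ S : Sublocale L, S ∈ joinsOfClosedSublocales L) (A : Set L) :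
    IsCompl (⨆ a ∈ A, closedSublocale a) (⨅ a ∈ A, openSublocale a) := by
  constructor
  · rw [disjoint_iff]
    obtain ⟨B, hB⟩ := hJ ((⨆ a ∈ A, closedSublocale a) ⊓ ⨅ a ∈ A, openSublocale a)
    rw [hB, ← le_bot_iff]
    refine iSup₂_le fun b hb => ?_
    have hle : closedSublocale b ≤ (⨆ a ∈ A, closedSublocale a) ⊓ ⨅ a ∈ A, openSublocale a :=
      hB ▸ le_biSup closedSublocale hb
    -- `𝔠 b ≤ 𝔬 a` is symmetric in `a` and `b`, so `⨆ a ∈ A, 𝔠 a ≤ 𝔬 b`.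
    have hA : ⨆ a ∈ A, closedSublocale a ≤ openSublocale b := iSup₂_le fun a ha => by
      rw [closedSublocale_le_openSublocale, sup_comm, ← closedSublocale_le_openSublocale]
      exact hle.trans (inf_le_right.trans (iInf₂_le a ha))
    exact ((isCompl_closedSublocale_openSublocale b).disjoint.eq_bot_of_le
      (hle.trans (inf_le_left.trans hA))).le
  · rw [codisjoint_iff_le_sup, sup_iInf₂_eq]
    refine le_iInf₂ fun a ha => ?_
    rw [← (isCompl_closedSublocale_openSublocale a).sup_eq_top]
    exact sup_le_sup_right
      (le_biSup closedSublocale ha) _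

lemma isScatteredFrame_of_forall_mem_joinsOfClosedSublocales
    (hJ : ∀ S : Sublocale L, S ∈ joinsOfClosedSublocales L) : IsScatteredFrame L := by
  refine ⟨fun S => ?_⟩
  obtain ⟨A, rfl⟩ := hJ S
  exact ⟨_, isCompl_iSup_closedSublocale_iInf_openSublocale hJ A⟩

lemma IsSubfit.mem_fittedSublocales (hL : IsSubfit L) (hS : IsScatteredFrame L)
    (S : Sublocale L) : S ∈ fittedSublocales L := by
  have : ComplementedLattice (Sublocale L) := hS
  have hJ := hL.mem_joinsOfClosedSublocales hS
  obtain ⟨T, hT⟩ := exists_isCompl S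
  obtain ⟨A, rfl⟩ := hJ T
  exact ⟨A, hT.symm.right_unique (isCompl_iSup_closedSublocale_iInf_openSublocale hJ A)⟩

/-- If closed sublocales are fitted, so is every sublocale `S`: it is an intersection of sublocales
`𝔬 y ⊔ 𝔠 z`, and these are intersections of sublocales `𝔬 y ⊔ 𝔬 b = 𝔬 (y ⊔ b)`. -/
lemma mem_fittedSublocales_of_forall_closedSublocale
    (hc : ∀ a : L, closedSublocale a ∈ fittedSublocales L) (S : Sublocale L) :
    S ∈ fittedSublocales L := by
  refine ⟨{a | S ≤ openSublocale a}, le_antisymm (le_iInf₂ fun a ha => ha) fun y hy => ?_⟩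
  have hy' (a : L) (ha : S ≤ openSublocale a) : a ⇨ y = y := mem_openSublocale.1
    ((iInf₂_le a ha : ⨅ a ∈ {a | S ≤ openSublocale a}, openSublocale a ≤ openSublocale a) hy)
  refine Sublocale.mem_of_restrict_le (mem_closedSublocale.1 ?_)
  have hS := S.le_openSublocale_sup_closedSublocale y
  obtain ⟨B, hB⟩ := hc (S.restrict y : L)
  rw [hB] at hS ⊢
  refine Sublocale.mem_iInf_of_forall fun b => Sublocale.mem_iInf_of_forall fun hb => ?_
  have hSb : S ≤ openSublocale (y ⊔ b) := by
    rw [openSublocale_sup]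
    exact hS.trans (sup_le_sup_left (iInf₂_le b hb) _)
  have := hy' _ hSb
  rwa [sup_himp_distrib, himp_self, top_inf_eq, ← mem_openSublocale] at this

lemma closedSublocale_mem_joinsOfClosedSublocales (a : L) :
    closedSublocale a ∈ joinsOfClosedSublocales L := ⟨{a}, by simp⟩

lemma IsSubfit.isScatteredFrame_iff_fittedSublocales_eq (hL : IsSubfit L) :
    IsScatteredFrame L ↔ fittedSublocales L = joinsOfClosedSublocales L := by
  constructor
  · intro hS
    exact Set.ext fun S =>
      iff_of_true (hL.mem_fittedSublocales hS S) (hL.mem_joinsOfClosedSublocales hS S)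
  · intro h
    refine isScatteredFrame_of_forall_mem_joinsOfClosedSublocales fun S => ?_
    rw [← h]
    refine mem_fittedSublocales_of_forall_closedSublocale (fun a => ?_) S
    rw [h]
    exact closedSublocale_mem_joinsOfClosedSublocales a

/-! ### Filters of elements above a point of an extension -/

/-- The filter `{a | d ≤ κ a}` of a map `κ` that preserves finite meets. -/
def filterAbove {C : Type v} [Order.Coframe C] {κ : L → C} (htop : κ ⊤ = ⊤)
    (hinf : ∀ a b, κ (a ⊓ b) = κ a ⊓ κ b) (d : C) : Order.PFilter L :=
  Order.IsPFilter.toPFilter (F := {a : L | d ≤ κ a}) <|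
    Order.IsPFilter.of_def ⟨⊤, le_top.trans htop.ge⟩
      (fun a ha b hb => ⟨a ⊓ b, (le_inf ha hb).trans (hinf a b).ge, inf_le_left, inf_le_right⟩)
      fun {a b} hab ha => ha.trans (by
        rw [← inf_eq_left.2 hab, hinf]
        exact inf_le_right)

lemma filterAbove_mem_stronglyExactFilters {C : Type v} [Order.Coframe C] {κ : L → C}
    (htop : κ ⊤ = ⊤) (hinf : ∀ a b, κ (a ⊓ b) = κ a ⊓ κ b)
    (hsInf : ∀ A : Set L, IsStronglyExactMeet A → κ (sInf A) = ⨅ a ∈ A, κ a) (d : C) :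
    filterAbove htop hinf d ∈ stronglyExactFilters L := by
  intro A hA hSE
  change d ≤ κ (sInf A)
  rw [hsInf A hSE]
  exact le_iInf₂ hA

/-- If strongly exact filters are exact, a fitted sublocale is complemented. The filter of those
`x` with `S ⊓ T ≤ 𝔬 x`, where `T` is the claimed complement, contains `⊥` because no `b ≠ ⊤` joins
to `⊤` with all its elements: such a `b` has `𝔠 b ≤ S` and so belongs to that filter itself. -/
lemma IsSubfit.isCompl_of_mem_fittedSublocales (hL : IsSubfit L)
    (h : stronglyExactFilters L = exactFilters L) {S : Sublocale L}
    (hS : S ∈ fittedSublocales L) :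
    IsCompl S (⨅ b ∈ {b | closedSublocale b ≤ S}, openSublocale b) := by
  obtain ⟨A, hA⟩ := hS
  set T := ⨅ b ∈ {b | closedSublocale b ≤ S}, openSublocale b with hT
  constructor
  · let G := filterAbove openSublocale_top openSublocale_inf (S ⊓ T)
    have hG : G ∈ exactFilters L := h ▸ filterAbove_mem_stronglyExactFilters _ _
      (fun A hA => hA.openSublocale_sInf) _
    have hbot : (⊥ : L) ∈ G := by
      refine hL.mem_of_forall_sup_eq_top hG fun b hb => ?_
      have hbS : closedSublocale b ≤ S := by
        rw [hA]
        refine le_iInf₂ fun a ha => closedSublocale_le_openSublocale.2 (hb a ?_)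
        exact inf_le_left.trans (hA.le.trans (iInf₂_le a ha))
      have hbG : b ∈ G := (inf_le_right.trans (iInf₂_le b hbS) : S ⊓ T ≤ openSublocale b)
      rw [bot_sup_eq, ← hb b hbG, sup_idem]
    have hle : S ⊓ T ≤ openSublocale ⊥ := hbot
    rwa [openSublocale_bot, ← disjoint_iff_inf_le] at hle
  · rw [codisjoint_iff_le_sup, hT, sup_iInf₂_eq]
    refine le_iInf₂ fun b hb => ?_
    rw [← (isCompl_closedSublocale_openSublocale b).sup_eq_top]
    exact sup_le_sup_right hb _

lemma IsSubfit.isScatteredFrame_of_stronglyExactFilters_eq (hL : IsSubfit L)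
    (h : stronglyExactFilters L = exactFilters L) : IsScatteredFrame L := by
  have hc (a : L) : closedSublocale a ∈ fittedSublocales L := by
    set T := ⨅ x ∈ {x | x ⊔ a = ⊤}, openSublocale x with hT
    have haT : closedSublocale a ≤ T := le_iInf₂ fun x hx => closedSublocale_le_openSublocale.2 hx
    have hTa (b : L) (hb : closedSublocale b ≤ T) : a ≤ b := by
      by_contra hab
      obtain ⟨u, hu, hu'⟩ := hL _ _ hab
      refine hu' ?_
      rw [sup_comm, ← closedSublocale_le_openSublocale]
      exact hb.trans (biInf_le openSublocale (show u ⊔ a = ⊤ by rwa [sup_comm]))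
    have hcompl : ⨅ b ∈ {b | closedSublocale b ≤ T}, openSublocale b = openSublocale a :=
      le_antisymm (biInf_le openSublocale (show closedSublocale a ≤ T from haT))
        (le_iInf₂ fun b hb => openSublocale_le_openSublocale.2 (hTa b hb))
    have hTcompl := hL.isCompl_of_mem_fittedSublocales h (S := T) ⟨_, hT⟩
    rw [hcompl] at hTcompl
    exact ⟨_, (isCompl_closedSublocale_openSublocale a).left_unique hTcompl⟩
  exact ⟨fun S => ⟨_, hL.isCompl_of_mem_fittedSublocales h
    (mem_fittedSublocales_of_forall_closedSublocale hc S)⟩⟩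

lemma IsSubfit.stronglyExactFilters_eq_exactFilters (hL : IsSubfit L)
    (hS : IsScatteredFrame L) : stronglyExactFilters L = exactFilters L := by
  refine subset_antisymm (fun F hF A hA hex => mem_of_iInf_openSublocale_le hF ?_)
    exactFilters_subset_stronglyExactFilters
  obtain ⟨B, hB⟩ := hL.mem_joinsOfClosedSublocales hS (⨅ f ∈ F, openSublocale f)
  rw [hB]
  refine iSup₂_le fun b hb => closedSublocale_le_openSublocale.2 ?_
  rw [hex b]
  refine iInf₂_eq_top.2 fun a ha => closedSublocale_le_openSublocale.1 ?_
  calc closedSublocale b ≤ ⨆ b ∈ B, closedSublocale b :=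
        le_biSup closedSublocale hb
    _ ≤ openSublocale a := hB.symm.le.trans (iInf₂_le a (hA a ha))

/-! ### Uniqueness of the Raney extension of a scattered subfit frame -/

namespace IsRaneyExtension

variable {C : Type v} [Order.Coframe C] {κ : L → C}

lemma monotone (hκ : IsRaneyExtension κ) : Monotone κ := fun _ _ hab => by
  rw [← inf_eq_left.2 hab, hκ.map_inf]
  exact inf_le_right

lemma map_sup (hκ : IsRaneyExtension κ) (a b : L) : κ (a ⊔ b) = κ a ⊔ κ b := by
  rw [← sSup_pair, hκ.map_sSup, iSup_pair]

lemma eq_iInf (hκ : IsRaneyExtension κ) (d : C) : d = ⨅ a ∈ {a | d ≤ κ a}, κ a := by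
  refine le_antisymm (le_iInf₂ fun a ha => ha) ?_
  obtain ⟨A, hA⟩ := hκ.meet_generates d
  conv_rhs => rw [hA]
  refine le_iInf₂ fun a ha => iInf₂_le a ?_
  exact hA.le.trans (iInf₂_le a ha)

/-- Over a subfit frame, an exact filter `F` is the filter of those `a` with
`⨅ f ∈ F, κ f ≤ κ a`. -/
lemma mem_of_iInf_le (hκ : IsRaneyExtension κ) (hL : IsSubfit L) {F : Order.PFilter L}
    (hF : F ∈ exactFilters L) {a : L} (ha : ⨅ f ∈ F, κ f ≤ κ a) : a ∈ F := by
  refine hL.mem_of_forall_sup_eq_top hF fun b hb => hκ.injective ?_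
  rw [hκ.map_top, hκ.map_sup, eq_top_iff]
  calc ⊤ ≤ ⨅ f ∈ F, (κ f ⊔ κ b) := le_iInf₂ fun f hf => by
        rw [← hκ.map_sup, hb f hf, hκ.map_top]
    _ = (⨅ f ∈ F, κ f) ⊔ κ b := (iInf₂_sup_eq _).symm
    _ ≤ κ a ⊔ κ b := sup_le_sup_right ha _

lemma le_of_iInf_le {D : Type w} [Order.Coframe D] {ι : L → D} (hκ : IsRaneyExtension κ)
    (hι : IsRaneyExtension ι) (hL : IsSubfit L)
    (h : stronglyExactFilters L = exactFilters L) {d : C} {a : L}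
    (ha : ⨅ x ∈ {x | d ≤ κ x}, ι x ≤ ι a) : d ≤ κ a :=
  hι.mem_of_iInf_le hL (F := filterAbove hκ.map_top hκ.map_inf d)
    (h ▸ filterAbove_mem_stronglyExactFilters _ _ hκ.map_sInf d) ha

end IsRaneyExtension

lemma IsSubfit.isRaneyExtension_openSublocale (hL : IsSubfit L) (hS : IsScatteredFrame L) :
    IsRaneyExtension (openSublocale : L → Sublocale L) where
  injective _ _ h := le_antisymm (openSublocale_le_openSublocale.1 h.le)
    (openSublocale_le_openSublocale.1 h.ge)
  map_sSup := openSublocale_sSup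
  map_top := openSublocale_top
  map_inf := openSublocale_inf
  map_sInf _ hA := hA.openSublocale_sInf
  meet_generates := hL.mem_fittedSublocales hS

/-- The two Raney extensions are compared through the filters `{a | d ≤ ι a}`, which are the same
in both. -/
lemma IsRaneyExtension.raneyIsomorphicOver {C : Type v} {D : Type w} [Order.Coframe C]
    [Order.Coframe D] {ι : L → C} {κ : L → D} (hι : IsRaneyExtension ι) (hκ : IsRaneyExtension κ)
    (hL : IsSubfit L) (h : stronglyExactFilters L = exactFilters L) :
    RaneyIsomorphicOver ι κ := by
  let e : C ≃ D :=
    { toFun := fun c => ⨅ a ∈ {a | c ≤ ι a}, κ a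
      invFun := fun d => ⨅ a ∈ {a | d ≤ κ a}, ι a
      left_inv := fun c => by
        have hset : {a | ⨅ x ∈ {x | c ≤ ι x}, κ x ≤ κ a} = {a | c ≤ ι a} :=
          Set.ext fun a => ⟨hι.le_of_iInf_le hκ hL h, fun ha => biInf_le κ ha⟩
        dsimp only
        rw [hset]
        exact (hι.eq_iInf c).symm
      right_inv := fun d => by
        have hset : {a | ⨅ x ∈ {x | d ≤ κ x}, ι x ≤ ι a} = {a | d ≤ κ a} :=
          Set.ext fun a => ⟨hκ.le_of_iInf_le hι hL h, fun ha => biInf_le ι ha⟩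
        dsimp only
        rw [hset]
        exact (hκ.eq_iInf d).symm }
  refine ⟨e.toOrderIso (fun c c' hcc => ?_) (fun d d' hdd => ?_), fun a => le_antisymm ?_ ?_⟩
  · exact biInf_mono fun a ha => hcc.trans ha
  · exact biInf_mono fun a ha => hdd.trans ha
  · exact biInf_le κ (show ι a ≤ ι a from le_rfl)
  · refine le_iInf₂ fun x hx => hκ.monotone ?_
    have : ι a = ι (a ⊓ x) := by rw [hι.map_inf, inf_eq_left.2 hx]
    exact inf_eq_left.1 (hι.injective this).symm

/-! ### Raney extensions from families of sublocales -/

/-- The relation `φ b ≤ 𝔬 a` between the indices of a family of sublocales and `L`. -/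
def openRel {α : Type v} (φ : α → Sublocale L) (b : α) (a : L) : Prop :=
  φ b ≤ openSublocale a

/-- The map sending `a` to the concept with the attribute `a`, whose objects are the `b` with
`φ b ≤ 𝔬 a`. -/
def conceptMap {α : Type v} (φ : α → Sublocale L) (a : L) : Concept α L (openRel φ) :=
  Concept.ofAttribute _ a

section conceptMap

variable {α : Type v} {φ : α → Sublocale L}

lemma le_conceptMap {c : Concept α L (openRel φ)} {a : L} : c ≤ conceptMap φ a ↔ a ∈ c.intent := by
  simp [conceptMap]

lemma ofObject_le_conceptMap {b : α} {a : L} :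
    Concept.ofObject (openRel φ) b ≤ conceptMap φ a ↔ φ b ≤ openSublocale a :=
  Concept.ofObject_le_ofAttribute_iff

lemma concept_le_iff_ofObject_le {c d : Concept α L (openRel φ)} :
    c ≤ d ↔ ∀ b, Concept.ofObject (openRel φ) b ≤ c → Concept.ofObject (openRel φ) b ≤ d := by
  simp only [Concept.ofObjects_le_iff, Set.singleton_subset_iff]
  exact Concept.extent_subset_extent_iff.symm

lemma concept_le_iff_le_conceptMap {c d : Concept α L (openRel φ)} :
    c ≤ d ↔ ∀ a, d ≤ conceptMap φ a → c ≤ conceptMap φ a := by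
  simp only [← Concept.intent_subset_intent_iff (c := d), Set.subset_def, le_conceptMap]

lemma conceptMap_mono : Monotone (conceptMap φ) := fun _ _ hab =>
  concept_le_iff_ofObject_le.2 fun _ hb => ofObject_le_conceptMap.2
    ((ofObject_le_conceptMap.1 hb).trans (openSublocale_le_openSublocale.2 hab))

lemma concept_eq_iInf (c : Concept α L (openRel φ)) :
    c = ⨅ a ∈ {a | c ≤ conceptMap φ a}, conceptMap φ a :=
  le_antisymm (le_iInf₂ fun _ ha => ha) (concept_le_iff_le_conceptMap.2 fun _ ha => biInf_le _ ha)

/-- The concept lattice of the relation `φ b ≤ 𝔬 a` is a coframe if the family `φ` is stable under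
intersection with closed sublocales. -/
abbrev conceptCoframe (hφ : ∀ x b, ∃ b', φ b' = closedSublocale x ⊓ φ b) :
    Order.Coframe (Concept α L (openRel φ)) :=
  .ofMinimalAxioms
    { iInf_sup_le_sup_sInf := fun c s => by
        refine concept_le_iff_le_conceptMap.2 fun x hx => concept_le_iff_ofObject_le.2 fun b hb => ?_
        have hc : c ≤ conceptMap φ x := le_sup_left.trans hx
        -- `𝔠 x ⊓ φ b ≤ 𝔬 y` means `φ b ≤ 𝔬 (x ⊔ y)`, so `b'` is an object of every `d ∈ s`.
        obtain ⟨b', hb'⟩ := hφ x b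
        have hs : Concept.ofObject (openRel φ) b' ≤ sInf s := by
          refine le_sInf fun d hd => concept_le_iff_le_conceptMap.2 fun y hy => ?_
          have hcd : c ⊔ d ≤ conceptMap φ (x ⊔ y) := sup_le
            (hc.trans (conceptMap_mono le_sup_left)) (hy.trans (conceptMap_mono le_sup_right))
          rw [ofObject_le_conceptMap, hb', closedSublocale_inf_le_openSublocale,
            ← ofObject_le_conceptMap]
          exact (hb.trans (iInf₂_le d hd)).trans hcd
        have := ofObject_le_conceptMap.1 (hs.trans (le_sup_right.trans hx))
        rw [hb', closedSublocale_inf_le_openSublocale, sup_idem] at this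
        exact ofObject_le_conceptMap.2 this }

/-- The hypothesis `hinj` says that the sublocales `φ b` below `𝔬 a` determine `a`. -/
lemma isRaneyExtension_conceptMap (hφ : ∀ x b, ∃ b', φ b' = closedSublocale x ⊓ φ b)
    (hinj : ∀ x a, (∀ b, φ b ≤ openSublocale x → φ b ≤ openSublocale a) → x ≤ a) :
    letI := conceptCoframe hφ
    IsRaneyExtension (conceptMap φ) := by
  let := conceptCoframe hφ
  have hle {x a : L} : conceptMap φ x ≤ conceptMap φ a ↔ x ≤ a := by
    refine ⟨fun h => hinj x a fun b hb => ?_, fun h => conceptMap_mono h⟩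
    exact ofObject_le_conceptMap.1 ((ofObject_le_conceptMap.2 hb).trans h)
  have hobj {A : Set L} {a : L} (h : ⨅ x ∈ A, openSublocale x ≤ openSublocale a) :
      ⨅ x ∈ A, conceptMap φ x ≤ conceptMap φ a := by
    refine concept_le_iff_ofObject_le.2 fun b hb => ofObject_le_conceptMap.2 (le_trans ?_ h)
    exact le_iInf₂ fun x hx => ofObject_le_conceptMap.1 (hb.trans (biInf_le _ hx))
  refine ⟨fun a b h => le_antisymm (hle.1 h.le) (hle.1 h.ge), fun A => ?_, ?_, fun a b => ?_,
    fun A hA => ?_, fun c => ⟨_, concept_eq_iInf c⟩⟩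
  · refine le_antisymm (concept_le_iff_le_conceptMap.2 fun x hx => ?_)
      (iSup₂_le fun a ha => conceptMap_mono (le_sSup ha))
    exact conceptMap_mono (sSup_le fun a ha => hle.1 ((le_biSup (conceptMap φ) ha).trans hx))
  · refine eq_top_iff.2 (concept_le_iff_ofObject_le.2 fun b _ => ofObject_le_conceptMap.2 ?_)
    exact openSublocale_top (L := L) ▸ le_top
  · refine le_antisymm (le_inf (conceptMap_mono inf_le_left) (conceptMap_mono inf_le_right)) ?_
    rw [← iInf_pair]
    exact hobj (by rw [iInf_pair, openSublocale_inf])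
  · exact le_antisymm (le_iInf₂ fun a ha => conceptMap_mono (sInf_le ha))
      (hobj hA.openSublocale_sInf.ge)

end conceptMap

/-- If `L` is subfit and its Raney extensions are isomorphic, those given by all sublocales and by
the closed sublocales are. The former realizes every strongly exact filter as `{a | d ≤ κ a}`, the
latter only exact filters, and exactness is invariant under automorphisms of `L`. -/
lemma IsSubfit.stronglyExactFilters_eq_of_isUniqueRaneyExtension (hL : IsSubfit L) {C : Type u}
    [Order.Coframe C] {ι : L → C} (hι : IsUniqueRaneyExtension ι) :
    stronglyExactFilters L = exactFilters L := by
  have hid : ∀ (x : L) (S : Sublocale L), ∃ T, id T = closedSublocale x ⊓ id S :=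
    fun _ _ => ⟨_, rfl⟩
  have hcl (x b : L) : ∃ b', closedSublocale b' = closedSublocale x ⊓ closedSublocale b :=
    ⟨x ⊔ b, closedSublocale_sup x b⟩
  obtain ⟨e₁, σ₁, h₁⟩ := @hι.2 _ (conceptCoframe hid) _ (isRaneyExtension_conceptMap hid
    fun x a h => openSublocale_le_openSublocale.1 (h _ le_rfl))
  obtain ⟨e₂, σ₂, h₂⟩ := @hι.2 _ (conceptCoframe hcl) _ (isRaneyExtension_conceptMap hcl
    fun x a h => by
      by_contra hxa
      obtain ⟨u, hu, hu'⟩ := hL x a hxa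
      exact hu' (closedSublocale_le_openSublocale.1
        (h u (closedSublocale_le_openSublocale.2 hu))))
  refine subset_antisymm (fun F hF A hA hex => mem_of_iInf_openSublocale_le hF ?_)
    exactFilters_subset_stronglyExactFilters
  let σ : L ≃o L := σ₁.symm.trans σ₂
  let e := e₁.symm.trans e₂
  have he (a : L) : e (conceptMap id a) = conceptMap closedSublocale (σ a) := by
    have : conceptMap id a = e₁ (ι (σ₁.symm a)) := by rw [h₁, σ₁.apply_symm_apply]
    change e₂ (e₁.symm (conceptMap id a)) = conceptMap closedSublocale (σ₂ (σ₁.symm a))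
    rw [this, e₁.symm_apply_apply, h₂]
  -- The element of the first concept lattice that realizes the filter `F`.
  let d : Concept (Sublocale L) L (openRel id) :=
    Concept.ofObject _ (⨅ f ∈ F, openSublocale f)
  have hd (a : L) : e d ≤ conceptMap closedSublocale (σ a) ↔
      ⨅ f ∈ F, openSublocale f ≤ openSublocale a := by
    rw [← he, e.le_iff_le]
    exact ofObject_le_conceptMap
  rw [← hd]
  refine concept_le_iff_ofObject_le.2 fun b hb => ofObject_le_conceptMap.2 ?_
  rw [closedSublocale_le_openSublocale]
  refine σ.symm.injective ?_
  rw [σ.symm.map_sup, σ.symm_apply_apply, map_top, hex]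
  refine iInf₂_eq_top.2 fun a ha => σ.injective ?_
  rw [σ.map_sup, σ.apply_symm_apply, map_top, ← closedSublocale_le_openSublocale,
    ← ofObject_le_conceptMap]
  exact hb.trans ((hd a).2 (biInf_le openSublocale (hA a ha)))

lemma RaneyIsomorphicOver.raneyIsomorphic {C : Type v} {D : Type w} [Order.Coframe C]
    [Order.Coframe D] {ι : L → C} {κ : L → D} (h : RaneyIsomorphicOver ι κ) :
    RaneyIsomorphic ι κ :=
  h.imp fun _ he => ⟨OrderIso.refl L, he⟩

lemma IsUniqueRaneyExtensionOver.isUniqueRaneyExtension {C : Type u} [Order.Coframe C]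
    {ι : L → C} (h : IsUniqueRaneyExtensionOver ι) : IsUniqueRaneyExtension ι :=
  ⟨h.1, fun D _ κ hκ => (h.2 D κ hκ).raneyIsomorphic⟩

end Frame

theorem mainTheorem4 {L : Type u} [Order.Frame L] (hL : IsSubfit L) :
    List.TFAE [
      IsScatteredFrame L,
      stronglyExactFilters L = exactFilters L ∧ exactFilters L = regularFilters L,
      stronglyExactFilters L = exactFilters L,
      ∃ (C : Type u) (_ : Order.Coframe C) (ι : L → C), IsUniqueRaneyExtension ι,
      ∃ (C : Type u) (_ : Order.Coframe C) (ι : L → C), IsUniqueRaneyExtensionOver ι,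
      fittedSublocales L = joinsOfClosedSublocales L,
      IsUniqueRaneyExtension (openSublocale : L → Sublocale L),
      IsUniqueRaneyExtensionOver (openSublocale : L → Sublocale L)] := by
  tfae_have 1 ↔ 6 := hL.isScatteredFrame_iff_fittedSublocales_eq
  tfae_have 2 ↔ 3 := ⟨And.left, fun h => ⟨h, hL.exactFilters_eq_regularFilters⟩⟩
  tfae_have 3 → 1 := hL.isScatteredFrame_of_stronglyExactFilters_eq
  tfae_have 1 → 8 := fun hS =>
    have hι := hL.isRaneyExtension_openSublocale hS
    ⟨hι, fun _ _ _ hκ =>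
      hι.raneyIsomorphicOver hκ hL (hL.stronglyExactFilters_eq_exactFilters hS)⟩
  tfae_have 8 → 7 := fun h => h.isUniqueRaneyExtension
  tfae_have 7 → 4 := fun h => ⟨_, _, _, h⟩
  tfae_have 8 → 5 := fun h => ⟨_, _, _, h⟩
  tfae_have 5 → 4 := fun ⟨C, _, ι, h⟩ => ⟨C, _, ι, h.isUniqueRaneyExtension⟩
  tfae_have 4 → 3 := fun ⟨_, _, _, h⟩ => hL.stronglyExactFilters_eq_of_isUniqueRaneyExtension h
  tfae_finish
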